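/- Let $V$ be a finite set with $|V|=n$, and let $E^{\mathcal O}$ be the set of ordered pairs $ij$ of distinct elements of $V$. In the Euclidean space $\mathbb R^{E^{\mathcal O}}$, for $q=(q_{ij})$ and a permutation $\sigma$ of $V$ let $q^*_{ij}=q_{ji}$ and $\sigma(q)_{ij}=q_{\sigma(i)\sigma(j)}$. Let $Q_n$ be the sum of the space of all vectors with $q^*=q$ and the space of all vectors of the form $(w_i-w_j)_{ij}$, $w\in\mathbb R^V$. For $S\subseteq V$ let $c(S)$ be the vector with $c(S)_{ij}=1$ if $i\in S$, $j\notin S$, and $c(S)_{ij}=0$ otherwise. The oriented cut cone is $OCut_n=\{\sum_{S\subseteq V}\alpha_S c(S):\alpha_S\ge 0\}\subset Q_n$. Its symmetry group is the group of all isometries of $Q_n$ (with the Euclidean metric of $\mathbb R^{E^{\mathcal O}}$) that map $OCut_n$ onto itself. (a) The symmetries of $OCut_n$ are exactly the maps $q\mapsto\sigma(q)$ and $q\mapsto\sigma(q)^*$, where $\sigma$ is a permutation of $V$. (b) If $n\ge 3$, then there is an isomorphism of the group $\Sigma_n\times\Sigma_2$ onto the symmetry group of $OCut_n$, under which $\sigma\in\Sigma_n$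 acts as $q\mapsto\sigma^{-1}(q)$ and the generator of $\Sigma_2$ acts as $q\mapsto q^*$. (c) The map $q\mapsto q^*$ coincides with switching by $V$. That is, a linear map $f$ of $\mathbb R^{E^{\mathcal O}}$ satisfies $f(c(S))=c(S\,\Delta\,V)$ for all $S\subseteq V$ if and only if $f(q)=q^*$ for all $q\in Q_n$. Moreover, for every facet $G$ of $OCut_n$, the conic hull $G^{\delta(V)}$ of the vectors $c(S\,\Delta\,V)$, over all $S\subseteq V$ with $c(S)\in G$, is a facet of $OCut_n$ and equals $G^*=\{q^*:q\in G\}$. -/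

import Mathlib

namespace OrientedCut

/-- The arcs `ij` of the complete directed graph on `V`: ordered pairs of distinct vertices. -/
abbrev Arc (V : Type*) : Type _ := {p : V × V // p.1 ≠ p.2}

/-- The Euclidean space of real vectors indexed by the arcs. -/
abbrev ArcSpace (V : Type*) : Type _ := EuclideanSpace ℝ (Arc V)

section

variable {V : Type*}

/-- The arc `ji` opposite to the arc `ij`. -/
def Arc.rev (a : Arc V) : Arc V := ⟨(a.1.2, a.1.1), a.2.symm⟩

/-- The arc `σ(i)σ(j)`, for an arc `ij` and a permutation `σ` of the vertices. -/
def Arc.perm (σ : Equiv.Perm V) (a : Arc V) : Arc V :=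
  ⟨(σ a.1.1, σ a.1.2), fun h => a.2 (σ.injective h)⟩

/-- The transpose `q*`, with coordinates `q*_{ij} = q_{ji}`. -/
def transpose (q : ArcSpace V) : ArcSpace V := WithLp.toLp 2 fun a => q a.rev

/-- The vector `σ(q)`, with coordinates `σ(q)_{ij} = q_{σ(i)σ(j)}`. -/
def relabel (σ : Equiv.Perm V) (q : ArcSpace V) : ArcSpace V :=
  WithLp.toLp 2 fun a => q (a.perm σ)

/-- The tension with potential `w`, with coordinates `w_i - w_j`. -/
def tension (w : V → ℝ) : ArcSpace V := WithLp.toLp 2 fun a => w a.1.1 - w a.1.2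

variable (V) in
/-- The subspace of symmetric vectors, `q* = q`. -/
def symmetricSpace : Submodule ℝ (ArcSpace V) where
  carrier := {q | transpose q = q}
  add_mem' := by
    intro p q hp hq
    ext a
    have h₁ := congrArg (fun r : ArcSpace V => r a) hp
    have h₂ := congrArg (fun r : ArcSpace V => r a) hq
    simp only [transpose, PiLp.add_apply] at h₁ h₂ ⊢
    rw [h₁, h₂]
  zero_mem' := by
    ext a
    simp [transpose]
  smul_mem' := by
    intro t q hq
    ext a
    have h := congrArg (fun r : ArcSpace V => r a) hq
    simp only [transpose, PiLp.smul_apply] at h ⊢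
    rw [h]

variable (V) in
/-- The space of weights, generated by all tensions. -/
def weightSpace : Submodule ℝ (ArcSpace V) := Submodule.span ℝ (Set.range tension)

variable (V) in
/-- The space `Q_n` of weighted vectors: symmetric vectors plus tensions. -/
def weightedSpace : Submodule ℝ (ArcSpace V) := symmetricSpace V ⊔ weightSpace V

variable [DecidableEq V]

/-- The incidence vector `c(S)` of the oriented cut of `S`: the coordinate at `ij` is `1` if
`i ∈ S` and `j ∉ S`, and `0` otherwise. -/
def ocut (S : Finset V) : ArcSpace V :=
  WithLp.toLp 2 fun a => if a.1.1 ∈ S ∧ a.1.2 ∉ S then 1 else 0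

variable [Fintype V]

/-- The conic hull of the vectors `c(S)` with `S` in the family `R`. -/
def conicHull (R : Set (Finset V)) : Set (ArcSpace V) :=
  {q | ∃ α : Finset V → ℝ, (∀ S, 0 ≤ α S) ∧ (∀ S, S ∉ R → α S = 0) ∧ q = ∑ S, α S • ocut S}

variable (V) in
/-- The oriented cut cone `OCut_n`. -/
def OCut : Set (ArcSpace V) :=
  {q | q ∈ weightedSpace V ∧
    ∃ α : Finset V → ℝ, (∀ S, 0 ≤ α S) ∧ q = ∑ S, α S • ocut S}

variable (V) in
/-- The symmetry group of `OCut_n`: all isometries of the Euclidean space `Q_n`, the linear span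
of the cone, that map the cone onto itself. -/
def symmetryGroup : Subgroup (weightedSpace V ≃ᵢ weightedSpace V) where
  carrier := {γ | ∀ q : weightedSpace V,
    ((γ q : weightedSpace V) : ArcSpace V) ∈ OCut V ↔ (q : ArcSpace V) ∈ OCut V}
  mul_mem' := fun {γ τ} hγ hτ q => (hγ (τ q)).trans (hτ q)
  one_mem' := fun _ => Iff.rfl
  inv_mem' := by
    intro γ hγ q
    have h := hγ (γ⁻¹ q)
    rw [IsometryEquiv.apply_inv_self] at h
    exact h.symm

/-- `G` is a facet of `OCut_n`: a face, cut out by a valid inequality `(g, q) ≥ 0` with facet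
vector `g ∈ Q_n`, of dimension one less than the cone. -/
def IsFacet (G : Set (ArcSpace V)) : Prop :=
  (∃ g ∈ weightedSpace V, (∀ q ∈ OCut V, 0 ≤ inner ℝ g q) ∧
    G = {q | q ∈ OCut V ∧ inner ℝ g q = 0}) ∧
  Module.finrank ℝ (Submodule.span ℝ G) + 1 = Module.finrank ℝ (Submodule.span ℝ (OCut V))

/-- The roots `R(G)`: the sets `S` whose vector `c(S)` lies on `G`. -/
def roots (G : Set (ArcSpace V)) : Set (Finset V) := {S | ocut S ∈ G}

/-- The switching of `G` by `T`: the conic hull of the vectors `c(S Δ T)`, for `S ∈ R(G)`. -/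
def switching (T : Finset V) (G : Set (ArcSpace V)) : Set (ArcSpace V) :=
  conicHull ((fun S => symmDiff S T) '' roots G)

end

end OrientedCut

/-! The cut vectors span `weightedSpace V` (`span_ocut`), so linear maps on it are determined by
their values on cuts. Transposing or relabelling a cut gives a cut, so these maps are symmetries.

Conversely, a symmetry is affine by Mazur-Ulam and fixes the apex (`symmetry_map_zero`), hence is a
linear isometry. Coordinates on the cone are nonnegative, so supports cannot cancel, and the
symmetry permutes the rays of nonzero cuts (`exists_map_cut`). It also preserves orthogonality, that
is, having no common arc. Among nonzero cuts, those of `S` with `|S| = 1` or `n - 1` are orthogonal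
to the most others (`card_eq_one_or_of_card_orthogonalCuts_le`), so singletons go to singletons or
their complements. Orthogonality and injectivity exclude a mixture of the two
(`exists_eq_relabelIso_or`). After a transposition if necessary, singletons go to singletons;
orthogonality to singletons then identifies every other cut, and norms fix the scale
(`eq_relabelIso`).

For the facets, transposition complements the set of a cut, and a face is the conic hull of its cuts
(`conicHull_roots`). -/

namespace OrientedCut

/-! ### Coordinates and supports of cut vectors -/

section Coordinates

variable {V : Type*}

@[simp] lemma transpose_apply (q : ArcSpace V) (a : Arc V) : transpose q a = q a.rev := rfl

@[simp] lemma relabel_apply (σ : Equiv.Perm V) (q : ArcSpace V) (a : Arc V) :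
    relabel σ q a = q (a.perm σ) := rfl

@[simp] lemma tension_apply (w : V → ℝ) (a : Arc V) : tension w a = w a.1.1 - w a.1.2 := rfl

@[simp] lemma Arc.rev_rev (a : Arc V) : a.rev.rev = a := rfl

@[simp] lemma transpose_transpose (q : ArcSpace V) : transpose (transpose q) = q := rfl

lemma transpose_relabel (σ : Equiv.Perm V) (q : ArcSpace V) :
    transpose (relabel σ q) = relabel σ (transpose q) := rfl

/-- The order is reversed: relabelling is a right action, which is why `symmetryHom` uses `σ⁻¹`. -/
lemma relabel_relabel (σ τ : Equiv.Perm V) (q : ArcSpace V) :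
    relabel σ (relabel τ q) = relabel (τ * σ) q := rfl

@[simp] lemma relabel_one (q : ArcSpace V) : relabel 1 q = q := rfl

lemma mem_symmetricSpace {q : ArcSpace V} : q ∈ symmetricSpace V ↔ transpose q = q := Iff.rfl

variable (V) in
/-- Transposition as a linear equivalence. -/
def transposeEquiv : ArcSpace V ≃ₗ[ℝ] ArcSpace V where
  toFun := transpose
  invFun := transpose
  map_add' _ _ := rfl
  map_smul' _ _ := rfl
  left_inv _ := rfl
  right_inv _ := rfl

@[simp] lemma transposeEquiv_apply (q : ArcSpace V) : transposeEquiv V q = transpose q := rfl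

/-- The action of a permutation of the vertices as a linear equivalence. -/
def relabelEquiv (σ : Equiv.Perm V) : ArcSpace V ≃ₗ[ℝ] ArcSpace V where
  toFun := relabel σ
  invFun := relabel σ⁻¹
  map_add' _ _ := rfl
  map_smul' _ _ := rfl
  left_inv q := by simp [relabel_relabel]
  right_inv q := by simp [relabel_relabel]

variable [DecidableEq V]

@[simp] lemma ocut_apply (S : Finset V) (a : Arc V) :
    ocut S a = if a.1.1 ∈ S ∧ a.1.2 ∉ S then 1 else 0 := rfl

lemma ocut_nonneg (S : Finset V) (a : Arc V) : 0 ≤ ocut S a := by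
  rw [ocut_apply]; split_ifs <;> norm_num

lemma ocut_ne_zero_iff (S : Finset V) (a : Arc V) :
    ocut S a ≠ 0 ↔ a.1.1 ∈ S ∧ a.1.2 ∉ S := by
  simp

lemma relabel_ocut (σ : Equiv.Perm V) (S : Finset V) :
    relabel σ (ocut S) = ocut (S.map (σ⁻¹).toEmbedding) := by
  ext a
  simp [Arc.perm, Finset.mem_map_equiv, Equiv.Perm.inv_def]

lemma ocut_empty : ocut (∅ : Finset V) = 0 := by
  ext a; simp

variable [Fintype V]

lemma transpose_ocut (S : Finset V) : transpose (ocut S) = ocut Sᶜ := by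
  ext a
  simp [Arc.rev, and_comm]

lemma ocut_univ : ocut (Finset.univ : Finset V) = 0 := by
  ext a; simp

lemma ocut_eq_zero_iff (S : Finset V) : ocut S = 0 ↔ S = ∅ ∨ S = Finset.univ := by
  refine ⟨fun h => ?_, by rintro (rfl | rfl); exacts [ocut_empty, ocut_univ]⟩
  by_contra! hS
  obtain ⟨h₁, h₂⟩ := hS
  obtain ⟨i, hi⟩ := h₁
  obtain ⟨j, hj⟩ : ∃ j, j ∉ S := by
    by_contra! hc
    exact h₂ (Finset.eq_univ_iff_forall.2 hc)
  have := (ocut_ne_zero_iff S ⟨(i, j), ne_of_mem_of_not_mem hi hj⟩).2 ⟨hi, hj⟩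
  rw [h] at this
  exact this rfl

/-- A nonzero cut whose support lies in the support of another one is equal to it. -/
lemma eq_of_support_subset {S T : Finset V} (hT : ocut T ≠ 0)
    (h : ∀ a, ocut T a ≠ 0 → ocut S a ≠ 0) : T = S := by
  simp only [ocut_ne_zero_iff] at h
  have hne : ¬ (T = ∅ ∨ T = Finset.univ) := fun hc => hT ((ocut_eq_zero_iff T).2 hc)
  push Not at hne
  obtain ⟨i, hi⟩ := hne.1
  obtain ⟨j, hj⟩ : ∃ j, j ∉ T := by
    by_contra! hc
    exact hne.2 (Finset.eq_univ_iff_forall.2 hc)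
  -- With `i ∈ T` and `j ∉ T` fixed, the arc `kj` tests `k ∈ T` and the arc `ik` tests `k ∉ T`.
  ext k
  refine ⟨fun hk => (h ⟨(k, j), ne_of_mem_of_not_mem hk hj⟩ ⟨hk, hj⟩).1, fun hk => ?_⟩
  by_contra hkT
  exact (h ⟨(i, k), ne_of_mem_of_not_mem hi hkT⟩ ⟨hi, hkT⟩).2 hk

end Coordinates

/-! ### The span of the cuts, and the rays of the cone -/

section Span

variable {V : Type*} [DecidableEq V]

/-- The antisymmetric part of a cut vector is half the tension of the indicator function of `S`. -/
lemma ocut_mem_weightedSpace (S : Finset V) : ocut S ∈ weightedSpace V := by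
  have h : ocut S = (1 / 2 : ℝ) • (ocut S + transpose (ocut S)) +
      (1 / 2 : ℝ) • tension (fun i => if i ∈ S then 1 else 0) := by
    ext a
    by_cases h₁ : a.1.1 ∈ S <;> by_cases h₂ : a.1.2 ∈ S <;>
      norm_num [Arc.rev, h₁, h₂]
  rw [h]
  refine Submodule.add_mem_sup (Submodule.smul_mem _ _ ?_) (Submodule.smul_mem _ _ ?_)
  · rw [mem_symmetricSpace]
    ext a
    simp only [transpose_apply, PiLp.add_apply, Arc.rev_rev]
    ring
  · exact Submodule.subset_span ⟨_, rfl⟩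

variable [Fintype V]

/-- The difference `c({i}) - c({i}ᶜ)` is the tension of the indicator of `i`; extend linearly. -/
lemma tension_eq_sum (w : V → ℝ) :
    tension w = ∑ i, w i • (ocut {i} - ocut {i}ᶜ) := by
  ext a
  simp only [tension_apply, WithLp.ofLp_sum, Finset.sum_apply, PiLp.smul_apply,
    PiLp.sub_apply, ocut_apply, Finset.mem_compl, Finset.mem_singleton, not_not, smul_eq_mul]
  have : ∀ i, w i * ((if a.1.1 = i ∧ ¬ a.1.2 = i then (1 : ℝ) else 0) -
      if ¬ a.1.1 = i ∧ a.1.2 = i then 1 else 0) =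
      (if a.1.1 = i then w i else 0) - if a.1.2 = i then w i else 0 := by
    intro i
    by_cases h₁ : a.1.1 = i <;> by_cases h₂ : a.1.2 = i <;> simp [h₁, h₂]
  simp [this]

/-- The combination `c({i}) + c({j}) - c({i,j})` is the indicator of the two arcs `ij` and `ji`. The
factor `1/2` appears because each such pair is counted once for either arc. -/
lemma symmetric_eq_sum {q : ArcSpace V} (hq : transpose q = q) :
    q = ∑ b : Arc V, (q b / 2) • (ocut {b.1.1} + ocut {b.1.2} - ocut {b.1.1, b.1.2}) := by
  ext a
  have hrev : q a.rev = q a := congrArg (fun r : ArcSpace V => r a) hq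
  have key : ∀ b : Arc V, (q b / 2) * (ocut {b.1.1} a + ocut {b.1.2} a -
      ocut {b.1.1, b.1.2} a) =
      (if b = a then q b / 2 else 0) + if b = a.rev then q b / 2 else 0 := by
    rintro ⟨⟨i, j⟩, hij⟩
    obtain ⟨⟨k, l⟩, hkl⟩ := a
    simp only [ne_eq] at hij hkl
    simp only [ocut_apply, Finset.mem_singleton, Finset.mem_insert, Arc.rev, Subtype.mk.injEq,
      Prod.mk.injEq]
    grind
  simp only [WithLp.ofLp_sum, Finset.sum_apply, PiLp.smul_apply, PiLp.sub_apply, PiLp.add_apply,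
    smul_eq_mul]
  rw [Finset.sum_congr rfl fun b _ => key b]
  simp [Finset.sum_add_distrib, hrev]

variable (V) in
lemma span_ocut : Submodule.span ℝ (Set.range (ocut : Finset V → ArcSpace V)) =
    weightedSpace V := by
  refine le_antisymm (Submodule.span_le.2 ?_) (sup_le ?_ (Submodule.span_le.2 ?_))
  · rintro _ ⟨S, rfl⟩
    exact ocut_mem_weightedSpace S
  · intro q hq
    rw [symmetric_eq_sum hq]
    have h := fun S : Finset V =>
      Submodule.subset_span (R := ℝ) (Set.mem_range_self (f := (ocut : Finset V → ArcSpace V)) S)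
    exact Submodule.sum_mem _ fun b _ => Submodule.smul_mem _ _
      (Submodule.sub_mem _ (Submodule.add_mem _ (h _) (h _)) (h _))
  · rintro _ ⟨w, rfl⟩
    rw [tension_eq_sum]
    exact Submodule.sum_mem _ fun i _ => Submodule.smul_mem _ _
      (Submodule.sub_mem _ (Submodule.subset_span ⟨_, rfl⟩) (Submodule.subset_span ⟨_, rfl⟩))

lemma linearMap_eq_on_weightedSpace {M : Type*} [AddCommGroup M] [Module ℝ M]
    {f g : ArcSpace V →ₗ[ℝ] M} (h : ∀ S, f (ocut S) = g (ocut S)) :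
    ∀ q ∈ weightedSpace V, f q = g q := by
  rw [← span_ocut]
  refine LinearMap.eqOn_span ?_
  rintro _ ⟨S, rfl⟩
  exact h S

lemma mem_OCut {q : ArcSpace V} :
    q ∈ OCut V ↔ ∃ α : Finset V → ℝ, (∀ S, 0 ≤ α S) ∧ q = ∑ S, α S • ocut S := by
  refine ⟨fun h => h.2, fun h => ⟨?_, h⟩⟩
  obtain ⟨α, -, rfl⟩ := h
  exact Submodule.sum_mem _ fun S _ => Submodule.smul_mem _ _ (ocut_mem_weightedSpace S)

lemma smul_ocut_mem_OCut {t : ℝ} (ht : 0 ≤ t) (S : Finset V) : t • ocut S ∈ OCut V := by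
  refine mem_OCut.2 ⟨fun T => if T = S then t else 0, fun T => ?_, ?_⟩
  · dsimp only; split_ifs <;> simp [ht]
  · simp [ite_smul]

lemma ocut_mem_OCut (S : Finset V) : ocut S ∈ OCut V := by
  simpa using smul_ocut_mem_OCut zero_le_one S

lemma zero_mem_OCut : (0 : ArcSpace V) ∈ OCut V :=
  mem_OCut.2 ⟨0, fun _ => le_rfl, by simp⟩

lemma smul_mem_OCut {t : ℝ} (ht : 0 ≤ t) {q : ArcSpace V} (hq : q ∈ OCut V) :
    t • q ∈ OCut V := by
  obtain ⟨α, hα, rfl⟩ := mem_OCut.1 hq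
  exact mem_OCut.2 ⟨fun S => t * α S, fun S => mul_nonneg ht (hα S), by
    simp [Finset.smul_sum, mul_smul]⟩

lemma sum_smul_ocut_apply (α : Finset V → ℝ) (a : Arc V) :
    (∑ S, α S • ocut S) a = ∑ S, α S * ocut S a := by
  simp

lemma nonneg_of_mem_OCut {q : ArcSpace V} (hq : q ∈ OCut V) (a : Arc V) : 0 ≤ q a := by
  obtain ⟨α, hα, rfl⟩ := mem_OCut.1 hq
  rw [sum_smul_ocut_apply]
  exact Finset.sum_nonneg fun S _ => mul_nonneg (hα S) (ocut_nonneg S a)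

/-- A vector of the cone supported in the support of `c(S)` lies on the ray of `c(S)`. -/
lemma exists_eq_smul_of_support_subset {q : ArcSpace V} (hq : q ∈ OCut V) (S : Finset V)
    (h : ∀ a, q a ≠ 0 → ocut S a ≠ 0) : ∃ t : ℝ, 0 ≤ t ∧ q = t • ocut S := by
  obtain ⟨α, hα, rfl⟩ := mem_OCut.1 hq
  refine ⟨α S, hα S, Finset.sum_eq_single S (fun T _ hTS => ?_) (by simp)⟩
  by_contra hne
  rw [smul_eq_zero, not_or] at hne
  refine hTS (eq_of_support_subset hne.2 fun a ha => h a ?_)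
  rw [sum_smul_ocut_apply]
  refine ne_of_gt (Finset.sum_pos' (fun U _ => mul_nonneg (hα U) (ocut_nonneg U a))
    ⟨T, Finset.mem_univ T, ?_⟩)
  exact mul_pos ((hα T).lt_of_ne' hne.1) ((ocut_nonneg T a).lt_of_ne' ha)

/-- Distinct nonzero cuts span distinct rays, since the support already determines the set. -/
lemma eq_of_smul_ocut_eq {S T : Finset V} {s t : ℝ} (hs : 0 < s)
    (h : s • ocut S = t • ocut T) (hS : ocut S ≠ 0) : S = T := by
  refine eq_of_support_subset hS fun a ha hT => ?_
  have := congrArg (fun r : ArcSpace V => r a) h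
  simp only [PiLp.smul_apply, smul_eq_mul, hT, mul_zero] at this
  exact (mul_ne_zero hs.ne' ha) this

end Span

/-! ### Transposition and relabelling as isometries preserving the cone -/

section Actions

variable {V : Type*}

lemma Arc.rev_bijective : Function.Bijective (Arc.rev : Arc V → Arc V) :=
  Function.Involutive.bijective fun _ => rfl

lemma Arc.perm_bijective (σ : Equiv.Perm V) :
    Function.Bijective (fun a : Arc V => a.perm σ) :=
  Function.bijective_iff_has_inverse.2 ⟨fun a => a.perm σ⁻¹, fun a => by simp [Arc.perm],
    fun a => by simp [Arc.perm]⟩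

variable [DecidableEq V] [Fintype V]

lemma inner_transpose_transpose (p q : ArcSpace V) :
    inner ℝ (transpose p) (transpose q) = inner ℝ p q := by
  simp only [PiLp.inner_apply, transpose_apply]
  exact Function.Bijective.sum_comp Arc.rev_bijective fun a => inner ℝ (p a) (q a)

lemma norm_transpose (q : ArcSpace V) : ‖transpose q‖ = ‖q‖ := by
  rw [norm_eq_sqrt_real_inner, norm_eq_sqrt_real_inner, inner_transpose_transpose]

lemma norm_relabel (σ : Equiv.Perm V) (q : ArcSpace V) : ‖relabel σ q‖ = ‖q‖ := by
  rw [norm_eq_sqrt_real_inner, norm_eq_sqrt_real_inner]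
  congr 1
  simp only [PiLp.inner_apply, relabel_apply]
  exact Function.Bijective.sum_comp (Arc.perm_bijective σ) fun a => inner ℝ (q a) (q a)

/-- A linear map sending cut vectors to cut vectors preserves the space of weighted vectors. -/
lemma map_mem_weightedSpace {f : ArcSpace V →ₗ[ℝ] ArcSpace V} {φ : Finset V → Finset V}
    (h : ∀ S, f (ocut S) = ocut (φ S)) {q : ArcSpace V} (hq : q ∈ weightedSpace V) :
    f q ∈ weightedSpace V := by
  have : weightedSpace V ≤ (weightedSpace V).comap f := by
    conv_lhs => rw [← span_ocut]
    refine Submodule.span_le.2 ?_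
    rintro _ ⟨S, rfl⟩
    rw [SetLike.mem_coe, Submodule.mem_comap, h]
    exact ocut_mem_weightedSpace _
  exact this hq

/-- A linear map sending cut vectors to cut vectors preserves the oriented cut cone. -/
lemma map_mem_OCut {f : ArcSpace V →ₗ[ℝ] ArcSpace V} {φ : Finset V → Finset V}
    (h : ∀ S, f (ocut S) = ocut (φ S)) {q : ArcSpace V} (hq : q ∈ OCut V) :
    f q ∈ OCut V := by
  obtain ⟨α, hα, rfl⟩ := mem_OCut.1 hq
  -- Coefficients are summed over the fibres of `φ`, which need not be injective.
  refine mem_OCut.2 ⟨fun T => ∑ S with φ S = T, α S,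
    fun T => Finset.sum_nonneg fun S _ => hα S, ?_⟩
  simp only [map_sum, map_smul, h]
  rw [← Finset.sum_fiberwise (g := φ)]
  refine Finset.sum_congr rfl fun T _ => ?_
  rw [Finset.sum_smul]
  refine Finset.sum_congr rfl fun S hS => ?_
  rw [(Finset.mem_filter.1 hS).2]

lemma transpose_mem_weightedSpace {q : ArcSpace V} (hq : q ∈ weightedSpace V) :
    transpose q ∈ weightedSpace V :=
  map_mem_weightedSpace (f := (transposeEquiv V).toLinearMap) transpose_ocut hq

lemma relabel_mem_weightedSpace (σ : Equiv.Perm V) {q : ArcSpace V} (hq : q ∈ weightedSpace V) :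
    relabel σ q ∈ weightedSpace V :=
  map_mem_weightedSpace (f := (relabelEquiv σ).toLinearMap) (relabel_ocut σ) hq

lemma transpose_mem_OCut_iff {q : ArcSpace V} : transpose q ∈ OCut V ↔ q ∈ OCut V := by
  have h : ∀ {q : ArcSpace V}, q ∈ OCut V → transpose q ∈ OCut V := fun hq =>
    map_mem_OCut (f := (transposeEquiv V).toLinearMap) transpose_ocut hq
  exact ⟨fun hq => h hq, h⟩

lemma relabel_mem_OCut_iff (σ : Equiv.Perm V) {q : ArcSpace V} :
    relabel σ q ∈ OCut V ↔ q ∈ OCut V := by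
  have h : ∀ (σ : Equiv.Perm V) {q : ArcSpace V}, q ∈ OCut V → relabel σ q ∈ OCut V :=
    fun σ _ hq => map_mem_OCut (f := (relabelEquiv σ).toLinearMap) (relabel_ocut σ) hq
  refine ⟨fun hq => ?_, h σ⟩
  simpa [relabel_relabel] using h σ⁻¹ hq

variable (V) in
/-- Transposition as an isometry of the space of weighted vectors. -/
def transposeIso : weightedSpace V ≃ₗᵢ[ℝ] weightedSpace V where
  toFun q := ⟨transpose q, transpose_mem_weightedSpace q.2⟩
  invFun q := ⟨transpose q, transpose_mem_weightedSpace q.2⟩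
  map_add' _ _ := rfl
  map_smul' _ _ := rfl
  left_inv _ := rfl
  right_inv _ := rfl
  norm_map' q := norm_transpose (q : ArcSpace V)

/-- The action of a permutation as an isometry of the space of weighted vectors. -/
def relabelIso (σ : Equiv.Perm V) : weightedSpace V ≃ₗᵢ[ℝ] weightedSpace V where
  toFun q := ⟨relabel σ q, relabel_mem_weightedSpace σ q.2⟩
  invFun q := ⟨relabel σ⁻¹ q, relabel_mem_weightedSpace σ⁻¹ q.2⟩
  map_add' _ _ := rfl
  map_smul' _ _ := rfl
  left_inv q := by simp [relabel_relabel]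
  right_inv q := by simp [relabel_relabel]
  norm_map' q := norm_relabel σ (q : ArcSpace V)

@[simp] lemma coe_transposeIso (q : weightedSpace V) :
    (transposeIso V q : ArcSpace V) = transpose q := rfl

@[simp] lemma coe_relabelIso (σ : Equiv.Perm V) (q : weightedSpace V) :
    (relabelIso σ q : ArcSpace V) = relabel σ q := rfl

end Actions

/-! ### Faces as conic hulls of cuts; switching and transposition of facets -/

section Facets

variable {V : Type*} [DecidableEq V] [Fintype V]

lemma conicHull_subset_OCut (R : Set (Finset V)) : conicHull R ⊆ OCut V := by
  rintro q ⟨α, hα, -, rfl⟩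
  exact mem_OCut.2 ⟨α, hα, rfl⟩

/-- A face of the cone is the conic hull of the cut vectors that it contains. -/
lemma conicHull_roots {g : ArcSpace V} (hg : ∀ q ∈ OCut V, 0 ≤ inner ℝ g q) :
    conicHull (roots {q | q ∈ OCut V ∧ inner ℝ g q = 0}) =
      {q | q ∈ OCut V ∧ inner ℝ g q = 0} := by
  ext q
  constructor
  · intro hq
    refine ⟨conicHull_subset_OCut _ hq, ?_⟩
    obtain ⟨α, -, h₀, rfl⟩ := hq
    rw [inner_sum]
    refine Finset.sum_eq_zero fun S _ => ?_
    rw [real_inner_smul_right]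
    by_cases hS : S ∈ roots {q | q ∈ OCut V ∧ inner ℝ g q = 0}
    · rw [hS.2, mul_zero]
    · rw [h₀ S hS, zero_mul]
  · rintro ⟨hq, h₀⟩
    obtain ⟨α, hα, rfl⟩ := mem_OCut.1 hq
    refine ⟨α, hα, fun S hS => ?_, rfl⟩
    -- Nonnegative terms with sum zero all vanish, so every cut with a nonzero coefficient lies on
    -- the face.
    rw [inner_sum, Finset.sum_eq_zero_iff_of_nonneg] at h₀
    · have := h₀ S (Finset.mem_univ S)
      rw [real_inner_smul_right, mul_eq_zero] at this
      exact this.resolve_right fun h => hS ⟨ocut_mem_OCut S, h⟩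
    · intro T _
      rw [real_inner_smul_right]
      exact mul_nonneg (hα T) (hg _ (ocut_mem_OCut T))

lemma transpose_image_conicHull (R : Set (Finset V)) :
    transpose '' conicHull R = conicHull ((fun S => Sᶜ) '' R) := by
  have h : ∀ R : Set (Finset V), ∀ q ∈ conicHull R,
      transpose q ∈ conicHull ((fun S => Sᶜ) '' R) := by
    rintro R _ ⟨α, hα, h₀, rfl⟩
    refine ⟨fun S => α Sᶜ, fun S => hα _, fun S hS => h₀ _ fun hc => hS ⟨Sᶜ, hc, by simp⟩, ?_⟩
    rw [← transposeEquiv_apply, map_sum]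
    simp only [map_smul, transposeEquiv_apply, transpose_ocut]
    exact (Function.Bijective.sum_comp (compl_bijective (α := Finset V))
      (fun S => α Sᶜ • ocut S)).symm.trans (by simp) |>.symm
  refine Set.Subset.antisymm ?_ fun q hq => ⟨transpose q, ?_, rfl⟩
  · rintro _ ⟨q, hq, rfl⟩
    exact h R q hq
  · have := h _ q hq
    rw [Set.image_image] at this
    simpa using this

/-- Both sides are the conic hull of the cuts of the complements of the roots; being a face is what
makes `G` the hull of its roots. -/
lemma switching_univ {G : Set (ArcSpace V)} (hG : IsFacet G) :
    switching Finset.univ G = transpose '' G := by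
  obtain ⟨⟨g, -, hg, rfl⟩, -⟩ := hG
  conv_rhs => rw [← conicHull_roots hg, transpose_image_conicHull]
  have : (fun S : Finset V => symmDiff S Finset.univ) = fun S => Sᶜ := by
    funext S
    exact symmDiff_top S
  rw [switching, this]

/-- Transposition is a self-adjoint involution preserving the cone, so the transposed facet vector
defines the transposed face; it also preserves dimension. -/
lemma IsFacet.transpose_image {G : Set (ArcSpace V)} (hG : IsFacet G) :
    IsFacet (transpose '' G) := by
  obtain ⟨⟨g, hgQ, hg, hG⟩, hdim⟩ := hG
  have hinner : ∀ q : ArcSpace V, inner ℝ (transpose g) q = inner ℝ g (transpose q) := fun q =>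
    inner_transpose_transpose g (transpose q)
  refine ⟨⟨transpose g, transpose_mem_weightedSpace hgQ, fun q hq => ?_, ?_⟩, ?_⟩
  · rw [hinner]
    exact hg _ (transpose_mem_OCut_iff.2 hq)
  · subst hG
    ext q
    constructor
    · rintro ⟨p, ⟨hp, h₀⟩, rfl⟩
      exact ⟨transpose_mem_OCut_iff.2 hp, by rw [hinner, transpose_transpose, h₀]⟩
    · rintro ⟨hq, h₀⟩
      exact ⟨transpose q, ⟨transpose_mem_OCut_iff.2 hq, by rw [← hinner, h₀]⟩, rfl⟩
  · have : Submodule.span ℝ (transpose '' G) =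
        (Submodule.span ℝ G).map (transposeEquiv V).toLinearMap := by
      rw [Submodule.map_span]; rfl
    rw [this, ← hdim]
    congr 1
    exact LinearEquiv.finrank_map_eq (transposeEquiv V) _

end Facets

/-! ### Classification of the symmetries -/

section Symmetries

variable {V : Type*} [DecidableEq V]

/-- The cut vector `c(S)` as a weighted vector. -/
def cut (S : Finset V) : weightedSpace V := ⟨ocut S, ocut_mem_weightedSpace S⟩

@[simp] lemma coe_cut (S : Finset V) : (cut S : ArcSpace V) = ocut S := rfl

variable [Fintype V]

lemma mem_symmetryGroup {γ : weightedSpace V ≃ᵢ weightedSpace V} :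
    γ ∈ symmetryGroup V ↔ ∀ q : weightedSpace V,
      ((γ q : weightedSpace V) : ArcSpace V) ∈ OCut V ↔ (q : ArcSpace V) ∈ OCut V := Iff.rfl

/-- A symmetry fixes the apex, as the cone is pointed. -/
lemma symmetry_map_zero {γ : weightedSpace V ≃ᵢ weightedSpace V} (hγ : γ ∈ symmetryGroup V) :
    γ 0 = 0 := by
  rw [mem_symmetryGroup] at hγ
  have hr : γ (γ.symm 0) = 0 := γ.apply_symm_apply 0
  -- Mazur-Ulam makes `γ` affine: if `γ r = 0`, then `γ (2r) = 2 γ r - γ 0 = -γ 0`. Hence both `γ 0`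
  -- and `-γ 0` lie in the cone.
  have h₁ : γ ((2 : ℝ) • γ.symm 0) = -γ 0 := by
    have e₁ := γ.toRealLinearIsometryEquiv_apply ((2 : ℝ) • γ.symm 0)
    have e₂ := γ.toRealLinearIsometryEquiv_apply (γ.symm 0)
    rw [hr, zero_sub] at e₂
    rw [map_smul, e₂] at e₁
    rw [sub_eq_iff_eq_add.1 e₁.symm]
    module
  have hp : ((γ 0 : weightedSpace V) : ArcSpace V) ∈ OCut V := (hγ 0).2 zero_mem_OCut
  have hr' : ((γ.symm 0 : weightedSpace V) : ArcSpace V) ∈ OCut V := by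
    rw [← hγ, hr]
    exact zero_mem_OCut
  have hn : ((-γ 0 : weightedSpace V) : ArcSpace V) ∈ OCut V := by
    rw [← h₁, hγ]
    exact smul_mem_OCut zero_le_two hr'
  ext a
  have h₂ := nonneg_of_mem_OCut hp a
  have h₃ := nonneg_of_mem_OCut hn a
  simp only [Submodule.coe_neg, PiLp.neg_apply] at h₃
  simp only [Submodule.coe_zero, PiLp.zero_apply]
  linarith

lemma cut_eq_zero_iff (S : Finset V) : cut S = 0 ↔ S = ∅ ∨ S = Finset.univ := by
  rw [← ocut_eq_zero_iff, ← coe_cut, Submodule.coe_eq_zero]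

lemma eq_of_smul_cut_eq {S T : Finset V} {s t : ℝ} (hs : 0 < s)
    (h : s • cut S = t • cut T) (hS : cut S ≠ 0) : S = T :=
  eq_of_smul_ocut_eq hs (congrArg Subtype.val h) fun h₀ => hS (Subtype.ext h₀)

lemma transposeIso_cut (S : Finset V) : transposeIso V (cut S) = cut Sᶜ :=
  Subtype.ext (transpose_ocut S)

lemma relabelIso_cut (σ : Equiv.Perm V) (S : Finset V) :
    relabelIso σ (cut S) = cut (S.map (σ⁻¹).toEmbedding) :=
  Subtype.ext (relabel_ocut σ S)

lemma isometry_ext {L M : weightedSpace V ≃ₗᵢ[ℝ] weightedSpace V}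
    (h : ∀ S, L (cut S) = M (cut S)) : L = M := by
  ext1 q
  have hspan : Submodule.span ℝ (Set.range (cut : Finset V → weightedSpace V)) = ⊤ := by
    apply Submodule.map_injective_of_injective (weightedSpace V).injective_subtype
    rw [Submodule.map_span, Submodule.map_top, Submodule.range_subtype, ← Set.range_comp]
    exact span_ocut V
  have := LinearMap.ext_on_range (f := L.toLinearEquiv.toLinearMap)
    (g := M.toLinearEquiv.toLinearMap) hspan h
  exact LinearMap.congr_fun this q

/-- The linear isometries that preserve the cone map rays of cuts to rays of cuts. -/
lemma exists_map_cut {L : weightedSpace V ≃ₗᵢ[ℝ] weightedSpace V}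
    (hL : ∀ q : weightedSpace V, (L q : ArcSpace V) ∈ OCut V ↔ (q : ArcSpace V) ∈ OCut V)
    {S : Finset V} (hS : cut S ≠ 0) :
    ∃ T, cut T ≠ 0 ∧ ∃ t : ℝ, 0 < t ∧ L (cut S) = t • cut T := by
  obtain ⟨α, hα, hsum⟩ := mem_OCut.1 ((hL (cut S)).2 (ocut_mem_OCut S))
  replace hsum : L (cut S) = ∑ T, α T • cut T := Subtype.ext (by simpa using hsum)
  obtain ⟨T, -, hT⟩ : ∃ T ∈ Finset.univ, α T • cut T ≠ 0 := by
    refine Finset.exists_ne_zero_of_sum_ne_zero ?_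
    rw [← hsum]
    exact fun h => hS ((map_eq_zero_iff L L.injective).1 h)
  rw [smul_ne_zero_iff] at hT
  -- Pulled back, this writes `cut S` as a nonnegative combination of vectors of the cone. Nothing
  -- cancels, so the support of `L.symm (cut T)` lies in that of `cut S`, which puts it on the same
  -- ray.
  have hback : cut S = ∑ U, α U • L.symm (cut U) := by
    rw [← L.symm_apply_apply (cut S), hsum]
    simp
  have hmem : ∀ U, (L.symm (cut U) : ArcSpace V) ∈ OCut V := fun U => by
    rw [← hL, L.apply_symm_apply]
    exact ocut_mem_OCut U
  obtain ⟨t, ht, hq⟩ := exists_eq_smul_of_support_subset (hmem T) S fun a ha => by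
    have h := congrArg (fun r : weightedSpace V => (r : ArcSpace V) a) hback
    simp only [coe_cut, Submodule.coe_sum, Submodule.coe_smul, WithLp.ofLp_sum,
      Finset.sum_apply, PiLp.smul_apply, smul_eq_mul] at h
    rw [h]
    refine ne_of_gt (Finset.sum_pos'
      (fun U _ => mul_nonneg (hα U) (nonneg_of_mem_OCut (hmem U) a)) ⟨T, Finset.mem_univ T, ?_⟩)
    exact mul_pos ((hα T).lt_of_ne' hT.1) ((nonneg_of_mem_OCut (hmem T) a).lt_of_ne' ha)
  replace hq : cut T = t • L (cut S) := by
    rw [← map_smul, ← L.symm_apply_eq]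
    exact Subtype.ext hq
  have ht₀ : t ≠ 0 := by
    rintro rfl
    exact hT.2 (by rw [hq, zero_smul])
  refine ⟨T, hT.2, t⁻¹, inv_pos.2 (ht.lt_of_ne' ht₀), ?_⟩
  rw [hq, inv_smul_smul₀ ht₀]

/-- Two cuts are orthogonal iff they have no common arc. -/
lemma inner_cut_eq_zero_iff (S T : Finset V) :
    inner ℝ (cut S) (cut T) = 0 ↔ S ∩ T = ∅ ∨ S ∪ T = Finset.univ := by
  have h : inner ℝ (cut S) (cut T) = ∑ a, ocut S a * ocut T a := by
    simp only [Submodule.coe_inner, coe_cut, PiLp.inner_apply]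
    exact Finset.sum_congr rfl fun a _ => mul_comm _ _
  rw [h, Finset.sum_eq_zero_iff_of_nonneg fun a _ => mul_nonneg (ocut_nonneg S a) (ocut_nonneg T a)]
  constructor
  · intro h₀
    by_contra! hne
    obtain ⟨⟨i, hi⟩, h₂⟩ := hne
    obtain ⟨j, hj⟩ : ∃ j, j ∉ S ∪ T := by
      by_contra! hc
      exact h₂ (Finset.eq_univ_iff_forall.2 hc)
    rw [Finset.mem_inter] at hi
    rw [Finset.mem_union, not_or] at hj
    have := h₀ ⟨(i, j), ne_of_mem_of_not_mem hi.1 hj.1⟩ (Finset.mem_univ _)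
    simp [hi, hj] at this
  · rintro (h₀ | h₀) a -
    · have := Finset.ext_iff.1 h₀ a.1.1
      simp at this
      by_cases h : a.1.1 ∈ S <;> simp [h, this]
    · have := Finset.ext_iff.1 h₀ a.1.2
      simp at this
      rcases this with h | h <;> simp [h]

lemma inner_cut_eq_zero_iff_of_map {L : weightedSpace V ≃ₗᵢ[ℝ] weightedSpace V}
    {S S' T T' : Finset V} {s t : ℝ} (hs : 0 < s) (ht : 0 < t)
    (hS : L (cut S) = s • cut S') (hT : L (cut T) = t • cut T') :
    inner ℝ (cut S) (cut T) = 0 ↔ inner ℝ (cut S') (cut T') = 0 := by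
  rw [← L.inner_map_map, hS, hT, Submodule.coe_inner, Submodule.coe_smul, Submodule.coe_smul,
    real_inner_smul_left, real_inner_smul_right, Submodule.coe_inner]
  simp [hs.ne', ht.ne']

/-- The cuts orthogonal to a given one. -/
def orthogonalCuts (S : Finset V) : Finset (Finset V) :=
  Sᶜ.powerset ∪ Finset.Icc Sᶜ Finset.univ

lemma mem_orthogonalCuts {S T : Finset V} :
    T ∈ orthogonalCuts S ↔ inner ℝ (cut S) (cut T) = 0 := by
  rw [inner_cut_eq_zero_iff, orthogonalCuts, Finset.mem_union, Finset.mem_powerset,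
    Finset.mem_Icc, Finset.subset_compl_iff_disjoint_left, Finset.disjoint_iff_inter_eq_empty]
  simp only [Finset.subset_univ, and_true]
  refine or_congr Iff.rfl ?_
  rw [Finset.eq_univ_iff_forall, Finset.subset_iff]
  simp only [Finset.mem_compl, Finset.mem_union, or_iff_not_imp_left]

/-- Inclusion-exclusion: the subsets and the supersets of `Sᶜ` have only `Sᶜ` in common. The zero
cuts `∅` and `univ` are counted too. -/
lemma card_orthogonalCuts (S : Finset V) :
    (orthogonalCuts S).card + 1 = 2 ^ Sᶜ.card + 2 ^ S.card := by
  have h : Sᶜ.powerset ∩ Finset.Icc Sᶜ Finset.univ = {Sᶜ} := by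
    ext T
    simp only [Finset.mem_inter, Finset.mem_powerset, Finset.mem_Icc,
      Finset.subset_univ, and_true, Finset.mem_singleton]
    exact ⟨fun h => h.1.antisymm h.2, fun h => by simp [h]⟩
  have h₂ := Finset.card_union_add_card_inter Sᶜ.powerset (Finset.Icc Sᶜ Finset.univ)
  rw [h, Finset.card_singleton, Finset.card_powerset,
    Finset.card_Icc_finset (Finset.subset_univ _)] at h₂
  rw [orthogonalCuts, h₂, Finset.card_univ, ← Finset.card_compl, compl_compl]

/-- Only sets of size `1` and `n - 1` have as many orthogonal cuts as a singleton. -/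
lemma card_eq_one_or_of_card_orthogonalCuts_le {S : Finset V} (hS : cut S ≠ 0) (i : V)
    (h : (orthogonalCuts {i}).card ≤ (orthogonalCuts S).card) : S.card = 1 ∨ Sᶜ.card = 1 := by
  rw [Ne, cut_eq_zero_iff, not_or, ← Finset.compl_eq_empty_iff, ← Ne, ← Ne,
    ← Finset.nonempty_iff_ne_empty, ← Finset.nonempty_iff_ne_empty, ← Finset.card_pos,
    ← Finset.card_pos] at hS
  have h₁ := card_orthogonalCuts ({i} : Finset V)
  have h₂ := card_orthogonalCuts S
  have hc := Finset.card_add_card_compl S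
  have hc₁ := Finset.card_add_card_compl ({i} : Finset V)
  rw [Finset.card_singleton] at h₁ hc₁
  by_contra! hne
  -- If both sides have at least two elements, the hypothesis reads `2^(x+y+3) + 2 ≤ 2^(x+2) +
  -- 2^(y+2)`. This fails because `2^x` and `2^y` are each at most `2^x * 2^y`.
  obtain ⟨x, hx⟩ : ∃ x, S.card = x + 2 := ⟨S.card - 2, by omega⟩
  obtain ⟨y, hy⟩ : ∃ y, Sᶜ.card = y + 2 := ⟨Sᶜ.card - 2, by omega⟩
  have hn : ({i}ᶜ : Finset V).card = x + y + 3 := by omega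
  rw [hx, hy] at h₂
  rw [hn] at h₁
  have hX : 1 ≤ 2 ^ x := Nat.one_le_two_pow
  have hY : 1 ≤ 2 ^ y := Nat.one_le_two_pow
  simp only [pow_add] at h₁ h₂
  nlinarith [mul_le_mul hX hY zero_le_one (Nat.zero_le _), Nat.mul_le_mul_left (2 ^ x) hY,
    Nat.mul_le_mul_right (2 ^ y) hX]

/-- A linear isometry that maps the rays of singleton cuts to rays of singleton cuts, and rays of
cuts to rays of cuts, is the action of a permutation. -/
lemma eq_relabelIso {L : weightedSpace V ≃ₗᵢ[ℝ] weightedSpace V}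
    (hL : ∀ S, cut S ≠ 0 → ∃ T, cut T ≠ 0 ∧ ∃ t : ℝ, 0 < t ∧ L (cut S) = t • cut T)
    {σ : Equiv.Perm V} (hσ : ∀ i, ∃ t : ℝ, 0 < t ∧ L (cut {i}) = t • cut {σ i}) :
    L = relabelIso σ⁻¹ := by
  refine isometry_ext fun S => ?_
  by_cases hS : cut S = 0
  · rw [hS, map_zero, map_zero]
  -- A nonzero cut is recovered from the singletons to which it is not orthogonal, a relation that
  -- `L` preserves.
  have hmem : ∀ {T : Finset V}, cut T ≠ 0 → ∀ i, i ∈ T ↔ inner ℝ (cut T) (cut {i}) ≠ 0 := by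
    intro T hT i
    rw [Ne, inner_cut_eq_zero_iff, not_or]
    rw [Ne, cut_eq_zero_iff, not_or] at hT
    constructor
    · intro hi
      refine ⟨fun h => ?_, fun h => ?_⟩
      · exact Finset.notMem_empty i (h ▸ Finset.mem_inter.2 ⟨hi, Finset.mem_singleton_self i⟩)
      · rw [Finset.union_eq_left.2 (Finset.singleton_subset_iff.2 hi)] at h
        exact hT.2 h
    · intro h
      by_contra hi
      exact h.1 (Finset.inter_singleton_of_notMem hi)
  obtain ⟨T, hT, t, ht, hST⟩ := hL S hS
  have hTS : T = S.map σ.toEmbedding := by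
    ext k
    obtain ⟨s, hs, hk⟩ := hσ (σ⁻¹ k)
    rw [show σ (σ⁻¹ k) = k from σ.apply_symm_apply k] at hk
    rw [hmem hT, Finset.mem_map_equiv, ← Equiv.Perm.inv_def, hmem hS, Ne, Ne,
      inner_cut_eq_zero_iff_of_map ht hs hST hk]
  have hR : relabelIso σ⁻¹ (cut S) = cut T := by
    rw [relabelIso_cut, hTS, inv_inv]
  have hnorm : ‖cut S‖ = t * ‖cut T‖ := by
    rw [← L.norm_map, hST, norm_smul, Real.norm_of_nonneg ht.le]
  rw [← (relabelIso σ⁻¹).norm_map, hR] at hnorm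
  -- The relabelling is an isometry as well, so `cut S` and `cut T` have equal norms.
  have : t = 1 := by
    have h₀ : ‖cut T‖ ≠ 0 := norm_ne_zero_iff.2 hT
    exact mul_right_cancel₀ h₀ (by rw [one_mul, ← hnorm])
  rw [hR, hST, this, one_smul]

lemma cut_singleton_ne_zero (h : 2 ≤ Fintype.card V) (i : V) : cut ({i} : Finset V) ≠ 0 := by
  rw [Ne, cut_eq_zero_iff, not_or]
  refine ⟨Finset.singleton_ne_empty i, fun hi => ?_⟩
  have := congrArg Finset.card hi
  rw [Finset.card_singleton, Finset.card_univ] at this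
  omega

/-- The linear isometries that preserve the cone map singletons to sets of size `1` or `n - 1`. -/
lemma exists_map_cut_singleton {L : weightedSpace V ≃ₗᵢ[ℝ] weightedSpace V}
    (hL : ∀ S, cut S ≠ 0 → ∃ T, cut T ≠ 0 ∧ ∃ t : ℝ, 0 < t ∧ L (cut S) = t • cut T)
    (hV : 2 ≤ Fintype.card V) (i : V) :
    ∃ T, (T.card = 1 ∨ Tᶜ.card = 1) ∧ ∃ t : ℝ, 0 < t ∧ L (cut {i}) = t • cut T := by
  -- Both `∅` and `univ` give the zero vector; letting `φ` fix them makes it injective on all sets.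
  -- It then embeds `orthogonalCuts {i}` into `orthogonalCuts (φ {i})`.
  have hall : ∀ S, ∃ T, (cut S = 0 → T = S) ∧ (cut S ≠ 0 → cut T ≠ 0) ∧
      ∃ t : ℝ, 0 < t ∧ L (cut S) = t • cut T := by
    intro S
    by_cases hS : cut S = 0
    · exact ⟨S, fun _ => rfl, fun h => absurd hS h, 1, one_pos, by simp [hS]⟩
    · obtain ⟨T, hT, h⟩ := hL S hS
      exact ⟨T, fun h₀ => absurd h₀ hS, fun _ => hT, h⟩
  choose φ hφ₀ hφ₁ t ht hφ using hall
  have hinj : Function.Injective φ := by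
    intro S T hST
    have key : ∀ {S T : Finset V}, φ S = φ T → cut S ≠ 0 → S = T := by
      intro S T hST hS
      refine eq_of_smul_cut_eq (s := t T) (t := t S) (ht T) (L.injective ?_) hS
      rw [map_smul, map_smul, hφ, hφ, hST, smul_smul, smul_smul, mul_comm]
    by_cases hS : cut S = 0
    · by_cases hT : cut T = 0
      · rw [← hφ₀ S hS, hST, hφ₀ T hT]
      · exact (key hST.symm hT).symm
    · exact key hST hS
  refine ⟨φ {i}, card_eq_one_or_of_card_orthogonalCuts_le
    (hφ₁ _ (cut_singleton_ne_zero hV i)) i ?_, t {i}, ht _, hφ _⟩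
  refine Finset.card_le_card_of_injOn φ (fun T hT => ?_) hinj.injOn
  rw [Finset.mem_coe, mem_orthogonalCuts] at hT ⊢
  exact (inner_cut_eq_zero_iff_of_map (ht _) (ht _) (hφ _) (hφ _)).1 hT

/-- A cone-preserving linear isometry is the action of a permutation, possibly transposed. -/
lemma exists_eq_relabelIso_or {L : weightedSpace V ≃ₗᵢ[ℝ] weightedSpace V}
    (hL : ∀ q : weightedSpace V, (L q : ArcSpace V) ∈ OCut V ↔ (q : ArcSpace V) ∈ OCut V)
    (hV : 2 ≤ Fintype.card V) :
    ∃ σ : Equiv.Perm V, L = relabelIso σ ∨ L = (relabelIso σ).trans (transposeIso V) := by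
  have hray := fun S => exists_map_cut hL (S := S)
  -- if singletons go to singletons, the isometry is a permutation
  have main : ∀ (M : weightedSpace V ≃ₗᵢ[ℝ] weightedSpace V),
      (∀ S, cut S ≠ 0 → ∃ T, cut T ≠ 0 ∧ ∃ t : ℝ, 0 < t ∧ M (cut S) = t • cut T) →
      (∀ i, ∃ k, ∃ t : ℝ, 0 < t ∧ M (cut {i}) = t • cut {k}) →
      ∃ σ : Equiv.Perm V, M = relabelIso σ := by
    intro M hM h
    choose f t ht hf using h
    have hinj : Function.Injective f := by
      intro i j hij
      refine Finset.singleton_injective (eq_of_smul_cut_eq (s := t j) (t := t i) (ht j)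
        (M.injective ?_) (cut_singleton_ne_zero hV i))
      rw [map_smul, map_smul, hf, hf, hij, smul_smul, smul_smul, mul_comm]
    exact ⟨(Equiv.ofBijective f (Finite.injective_iff_bijective.1 hinj))⁻¹,
      eq_relabelIso hM fun i => ⟨t i, ht i, hf i⟩⟩
  have hsing := fun i => exists_map_cut_singleton hray hV i
  by_cases hall : ∀ i, ∃ k, ∃ t : ℝ, 0 < t ∧ L (cut {i}) = t • cut {k}
  · obtain ⟨σ, hσ⟩ := main L hray hall
    exact ⟨σ, Or.inl hσ⟩
  push Not at hall
  obtain ⟨i, hi⟩ := hall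
  have hcompl : ∀ j, (∀ k, ∀ t : ℝ, 0 < t → L (cut {j}) ≠ t • cut {k}) →
      ∃ k, ∃ t : ℝ, 0 < t ∧ L (cut {j}) = t • cut {k}ᶜ := by
    intro j hj
    obtain ⟨T, hT | hT, t, ht, h⟩ := hsing j
    · obtain ⟨k, rfl⟩ := Finset.card_eq_one.1 hT
      exact absurd h (hj k t ht)
    · obtain ⟨k, hk⟩ := Finset.card_eq_one.1 hT
      exact ⟨k, t, ht, by rw [← hk, compl_compl, h]⟩
  obtain ⟨a, s, hs, ha⟩ := hcompl i hi
  -- For `n = 2` the complement of a singleton is a singleton, contrary to the choice of `i`.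
  have hV₃ : 3 ≤ Fintype.card V := by
    by_contra hlt
    have h₁ : ({a}ᶜ : Finset V).card = 1 := by
      rw [Finset.card_compl, Finset.card_singleton]; omega
    obtain ⟨k, hk⟩ := Finset.card_eq_one.1 h₁
    exact hi k s hs (by rw [← hk, ha])
  -- a singleton and the complement of another one cannot both be images of singletons
  have hne : ∀ {j k : V} {t : ℝ}, j ≠ i → 0 < t → L (cut {j}) = t • cut {k} → k = a := by
    intro j k t hj ht h
    have h₀ : inner ℝ (cut ({j} : Finset V)) (cut {i}) = 0 :=
      (inner_cut_eq_zero_iff _ _).2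
        (Or.inl (Finset.inter_singleton_of_notMem (by simpa using hj.symm)))
    rw [inner_cut_eq_zero_iff_of_map ht hs h ha, inner_cut_eq_zero_iff] at h₀
    by_contra hka
    rcases h₀ with h₀ | h₀
    · have : k ∈ ({k} ∩ {a}ᶜ : Finset V) := by simp [hka]
      rw [h₀] at this
      exact Finset.notMem_empty k this
    · have : a ∈ ({k} ∪ {a}ᶜ : Finset V) := h₀ ▸ Finset.mem_univ a
      simp at this
      exact hka this.symm
  have hall : ∀ j, ∃ k, ∃ t : ℝ, 0 < t ∧ L (cut {j}) = t • cut {k}ᶜ := by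
    intro j
    by_cases hji : j = i
    · exact hji ▸ ⟨a, s, hs, ha⟩
    refine hcompl j fun k t ht h => ?_
    obtain rfl := hne hji ht h
    -- Suppose `{i}` goes to `{k}ᶜ` and `{j}` to `{k}`. By orthogonality a third singleton `{l}`
    -- would have to go to `{k}` or `{k}ᶜ` too, contradicting injectivity.
    obtain ⟨l, hl⟩ : ∃ l, l ∉ ({i, j} : Finset V) := by
      by_contra! hc
      have h₁ := Finset.card_le_two (a := i) (b := j)
      rw [Finset.eq_univ_iff_forall.2 hc, Finset.card_univ] at h₁
      omega
    simp only [Finset.mem_insert, Finset.mem_singleton, not_or] at hl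
    by_cases hsl : ∃ m, ∃ r : ℝ, 0 < r ∧ L (cut {l}) = r • cut {m}
    · obtain ⟨m, r, hr, hm⟩ := hsl
      obtain rfl := hne hl.1 hr hm
      refine hl.2 (Finset.singleton_injective (eq_of_smul_cut_eq (s := t) (t := r) ht
        (L.injective ?_) (cut_singleton_ne_zero hV l)))
      rw [map_smul, map_smul, h, hm, smul_smul, smul_smul, mul_comm]
    · push Not at hsl
      obtain ⟨m, r, hr, hm⟩ := hcompl l hsl
      have h₀ : inner ℝ (cut ({j} : Finset V)) (cut {l}) = 0 :=
        (inner_cut_eq_zero_iff _ _).2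
          (Or.inl (Finset.inter_singleton_of_notMem (by simpa using hl.2)))
      rw [inner_cut_eq_zero_iff_of_map ht hr h hm, inner_cut_eq_zero_iff] at h₀
      have hmk : m = k := by
        by_contra hmk
        rcases h₀ with h₀ | h₀
        · have : k ∈ ({k} ∩ {m}ᶜ : Finset V) := by simp [Ne.symm hmk]
          rw [h₀] at this
          exact Finset.notMem_empty k this
        · have : m ∈ ({k} ∪ {m}ᶜ : Finset V) := h₀ ▸ Finset.mem_univ m
          simp at this
          exact hmk this
      subst hmk
      refine hl.1 (Finset.singleton_injective (eq_of_smul_cut_eq (s := s) (t := r) hs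
        (L.injective ?_) (cut_singleton_ne_zero hV l)))
      rw [map_smul, map_smul, ha, hm, smul_smul, smul_smul, mul_comm]
  -- All singletons go to complements of singletons, so `L` followed by transposition is covered by
  -- `main`.
  obtain ⟨σ, hσ⟩ := main (L.trans (transposeIso V)) (fun S hS => by
      obtain ⟨T, hT, t, ht, h⟩ := hray S hS
      refine ⟨Tᶜ, ?_, t, ht, by
        rw [LinearIsometryEquiv.trans_apply, h, map_smul, transposeIso_cut]⟩
      rw [← transposeIso_cut]
      exact (map_ne_zero_iff _ (transposeIso V).injective).2 hT) fun i => by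
      obtain ⟨k, t, ht, h⟩ := hall i
      exact ⟨k, t, ht, by
        rw [LinearIsometryEquiv.trans_apply, h, map_smul, transposeIso_cut, compl_compl]⟩
  refine ⟨σ, Or.inr ?_⟩
  rw [← hσ]
  rfl

theorem mem_symmetryGroup_iff (γ : weightedSpace V ≃ᵢ weightedSpace V) :
    γ ∈ symmetryGroup V ↔ ∃ σ : Equiv.Perm V,
      (∀ q, (γ q : ArcSpace V) = relabel σ q) ∨
      (∀ q, (γ q : ArcSpace V) = transpose (relabel σ q)) := by
  constructor
  · intro hγ
    by_cases hV : 2 ≤ Fintype.card V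
    · obtain ⟨σ, h⟩ := exists_eq_relabelIso_or
        (L := γ.toRealLinearIsometryEquivOfMapZero (symmetry_map_zero hγ)) hγ hV
      refine ⟨σ, h.imp (fun h q => ?_) fun h q => ?_⟩
      · exact congrArg (fun M : weightedSpace V ≃ₗᵢ[ℝ] weightedSpace V => (M q : ArcSpace V)) h
      · exact congrArg (fun M : weightedSpace V ≃ₗᵢ[ℝ] weightedSpace V => (M q : ArcSpace V)) h
    -- With at most one vertex there are no arcs, so all vectors coincide.
    · have : Subsingleton V := Fintype.card_le_one_iff_subsingleton.1 (by omega)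
      refine ⟨1, Or.inl fun q => ?_⟩
      ext a
      exact absurd (Subsingleton.elim _ _) a.2
  · rintro ⟨σ, h | h⟩ q
    · rw [h, relabel_mem_OCut_iff]
    · rw [h, transpose_mem_OCut_iff, relabel_mem_OCut_iff]

end Symmetries

/-! ### The isomorphism with the direct product -/

section Group

variable {V : Type*} [DecidableEq V] [Fintype V]

variable (V) in
/-- The action of `Σ_2` on weighted vectors, in which the transposition acts by `q ↦ q*`. -/
noncomputable def transposeAction (τ : Equiv.Perm (Fin 2)) : weightedSpace V ≃ₗᵢ[ℝ] weightedSpace V :=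
  if τ = 1 then LinearIsometryEquiv.refl ℝ _ else transposeIso V

lemma perm_fin_two (τ : Equiv.Perm (Fin 2)) : τ = 1 ∨ τ = Equiv.swap 0 1 := by
  revert τ
  decide

lemma transposeAction_one : transposeAction V 1 = LinearIsometryEquiv.refl ℝ _ := if_pos rfl

lemma transposeAction_swap : transposeAction V (Equiv.swap 0 1) = transposeIso V :=
  if_neg (by decide)

variable (V) in
/-- The action of `Σ_n × Σ_2` by symmetries of the oriented cut cone. -/
noncomputable def symmetryHom : Equiv.Perm V × Equiv.Perm (Fin 2) →* symmetryGroup V where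
  toFun p := ⟨((relabelIso p.1⁻¹).trans (transposeAction V p.2)).toIsometryEquiv, by
    obtain ⟨σ, τ⟩ := p
    rw [mem_symmetryGroup_iff]
    refine ⟨σ⁻¹, ?_⟩
    obtain rfl | rfl := perm_fin_two τ
    · left
      intro q
      simp [transposeAction_one]
    · right
      intro q
      simp [transposeAction_swap]⟩
  map_one' := by
    refine Subtype.ext (IsometryEquiv.ext fun q => Subtype.ext ?_)
    simp [transposeAction_one]
  map_mul' := by
    rintro ⟨σ, τ⟩ ⟨σ', τ'⟩
    refine Subtype.ext (IsometryEquiv.ext fun q => Subtype.ext ?_)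
    obtain rfl | rfl := perm_fin_two τ <;> obtain rfl | rfl := perm_fin_two τ' <;>
      simp [transposeAction_one, transposeAction_swap, relabel_relabel, transpose_relabel]

lemma symmetryHom_one_right (σ : Equiv.Perm V) (q : weightedSpace V) :
    ((symmetryHom V (σ, 1)).1 q : ArcSpace V) = relabel σ⁻¹ q := by
  simp [symmetryHom, transposeAction_one]

lemma symmetryHom_swap (σ : Equiv.Perm V) (q : weightedSpace V) :
    ((symmetryHom V (σ, Equiv.swap 0 1)).1 q : ArcSpace V) =
      transpose (relabel σ⁻¹ q) := by
  simp [symmetryHom, transposeAction_swap]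

lemma symmetryHom_surjective : Function.Surjective (symmetryHom V) := by
  rintro ⟨γ, hγ⟩
  obtain ⟨σ, h | h⟩ := (mem_symmetryGroup_iff γ).1 hγ
  · refine ⟨(σ⁻¹, 1), Subtype.ext (IsometryEquiv.ext fun q => Subtype.ext ?_)⟩
    rw [symmetryHom_one_right, inv_inv, h]
  · refine ⟨(σ⁻¹, Equiv.swap 0 1), Subtype.ext (IsometryEquiv.ext fun q => Subtype.ext ?_)⟩
    rw [symmetryHom_swap, inv_inv, h]

/-- Without transposition, `{i}` goes to `{σ i}`, which forces `σ = 1`. With it, `{i}` goes to a set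
of size `n - 1 ≠ 1`. For `n = 2` the swap of the two vertices acts as transposition, and injectivity
fails. -/
lemma symmetryHom_injective (hV : 3 ≤ Fintype.card V) : Function.Injective (symmetryHom V) := by
  rw [injective_iff_map_eq_one]
  rintro ⟨σ, τ⟩ h
  have h₁ : ∀ i : V, ((symmetryHom V (σ, τ)).1 (cut {i}) : ArcSpace V) = ocut {i} := fun i => by
    rw [h]; rfl
  have hne : ∀ i : V, ocut ({i} : Finset V) ≠ 0 := fun i h =>
    cut_singleton_ne_zero (by omega) i (Subtype.ext h)
  have heq : ∀ {i : V} {T : Finset V}, ocut T = ocut {i} → {i} = T := fun {i T} h =>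
    eq_of_smul_ocut_eq one_pos (by rw [h]) (hne i) (t := 1)
  obtain rfl | rfl := perm_fin_two τ
  · refine Prod.ext (Equiv.ext fun i => ?_) rfl
    have h₂ := h₁ i
    rw [symmetryHom_one_right, coe_cut, relabel_ocut, inv_inv, Finset.map_singleton] at h₂
    exact (Finset.singleton_injective (heq h₂)).symm
  · obtain ⟨i⟩ : Nonempty V := Fintype.card_pos_iff.1 (by omega)
    have h₂ := h₁ i
    rw [symmetryHom_swap, coe_cut, relabel_ocut, transpose_ocut, Finset.map_singleton] at h₂
    have h₃ := congrArg Finset.card (heq h₂)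
    rw [Finset.card_compl, Finset.card_singleton, Finset.card_singleton] at h₃
    omega

end Group

end OrientedCut

theorem mainTheorem6 (V : Type*) [Fintype V] [DecidableEq V] :
    -- the symmetries are exactly the maps `q ↦ σ(q)` and `q ↦ σ(q)*`
    (∀ γ : OrientedCut.weightedSpace V ≃ᵢ OrientedCut.weightedSpace V,
      γ ∈ OrientedCut.symmetryGroup V ↔
        ∃ σ : Equiv.Perm V,
          (∀ q, (γ q : OrientedCut.ArcSpace V) = OrientedCut.relabel σ q) ∨
          (∀ q, (γ q : OrientedCut.ArcSpace V) =
            OrientedCut.transpose (OrientedCut.relabel σ q))) ∧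
    -- for `n ≥ 3` this is the direct product of `Σ_n` and `Σ_2`
    (3 ≤ Fintype.card V →
      ∃ Φ : Equiv.Perm V × Equiv.Perm (Fin 2) ≃* OrientedCut.symmetryGroup V,
        (∀ (σ : Equiv.Perm V) (q : OrientedCut.weightedSpace V),
          ((Φ (σ, 1)).1 q : OrientedCut.ArcSpace V) = OrientedCut.relabel σ⁻¹ q) ∧
        (∀ q : OrientedCut.weightedSpace V,
          ((Φ (1, Equiv.swap 0 1)).1 q : OrientedCut.ArcSpace V) =
            OrientedCut.transpose q)) ∧
    -- on `Q_n`, the transpose is the linear map given by switching by `V`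
    (∀ f : OrientedCut.ArcSpace V →ₗ[ℝ] OrientedCut.ArcSpace V,
      (∀ S : Finset V,
        f (OrientedCut.ocut S) = OrientedCut.ocut (symmDiff S Finset.univ)) ↔
      ∀ q ∈ OrientedCut.weightedSpace V, f q = OrientedCut.transpose q) ∧
    -- on facets, the transpose is switching by `V`
    (∀ G : Set (OrientedCut.ArcSpace V), OrientedCut.IsFacet G →
      OrientedCut.IsFacet (OrientedCut.switching Finset.univ G) ∧
      OrientedCut.switching Finset.univ G = OrientedCut.transpose '' G) := by
  refine ⟨OrientedCut.mem_symmetryGroup_iff, fun hV => ?_, fun f => ?_, fun G hG => ?_⟩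
  · refine ⟨MulEquiv.ofBijective (OrientedCut.symmetryHom V)
      ⟨OrientedCut.symmetryHom_injective hV, OrientedCut.symmetryHom_surjective⟩,
      OrientedCut.symmetryHom_one_right, fun q => ?_⟩
    exact OrientedCut.symmetryHom_swap 1 q
  · have hsymm : ∀ S : Finset V, OrientedCut.ocut (symmDiff S Finset.univ) =
        OrientedCut.transpose (OrientedCut.ocut S) := fun S => by
      rw [OrientedCut.transpose_ocut]
      exact congrArg OrientedCut.ocut (symmDiff_top S)
    constructor
    -- The cuts span `Q_n`, so agreement with the transpose on cuts extends to all of `Q_n`.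
    · intro h
      exact OrientedCut.linearMap_eq_on_weightedSpace
        (g := (OrientedCut.transposeEquiv V).toLinearMap) fun S => (h S).trans (hsymm S)
    · intro h S
      rw [h _ (OrientedCut.ocut_mem_weightedSpace S), hsymm]
  · rw [OrientedCut.switching_univ hG]
    exact ⟨hG.transpose_image, rfl⟩
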